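/- Let $\mathbb{H}$ be the real quaternions and let $M,N,d$ be natural numbers. For a quaternion matrix $Q\in\mathbb{H}^{m\times n}$ with singular values $\sigma_1(Q)\ge\sigma_2(Q)\ge\dots\ge\sigma_{\min(m,n)}(Q)\ge 0$ (the diagonal entries in a quaternion singular value decomposition $Q=A\,\Sigma\,B^H$ with $A,B$ unitary quaternion matrices and $\Sigma$ real rectangular diagonal), put $\|Q\|_{Q\text{-}S_p}=\bigl(\sum_{k=1}^{\min(m,n)}\sigma_k(Q)^p\bigr)^{1/p}$ for $0<p<\infty$, $\|Q\|_*=\|Q\|_{Q\text{-}S_1}$ and $\|Q\|_F=\bigl(\sum_{i,j}|q_{ij}|^2\bigr)^{1/2}$. Let $X\in\mathbb{H}^{M\times N}$ with $\operatorname{rank}(X)\le d$ (rank being the dimension of the right $\mathbb{H}$-span of the columns), and define the quaternion Frobenius/nuclear norm of $X$ as $$\|X\|_{Q\text{-}FNN}=\min_{\substack{U\in\mathbb{H}^{M\times d},\ V\in\mathbb{H}^{N\times d}\\ X=UV^H}}\left[\frac{\|U\|_F^2+2\|V\|_*}{3}\right]^{3/2}.$$ Then this minimum is attained, and it equals the Schatten-$2/3$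 quasi-norm of $X$: $$\|X\|_{Q\text{-}FNN}=\|X\|_{Q\text{-}S_{2/3}}.$$ -/

import Mathlib

open Matrix
open scoped Quaternion

namespace QuaternionMatrix


lemma re_dot {n : ℕ} (x y : Fin n → ℍ[ℝ]) :
    (star x ⬝ᵥ y).re = inner ℝ (WithLp.toLp 2 x) (WithLp.toLp 2 y) := by
  rw [PiLp.inner_apply]
  simp only [dotProduct, Quaternion.inner_def, Pi.star_apply]
  have : ∀ f : Fin n → ℍ[ℝ], (∑ i, f i).re = ∑ i, (f i).re := fun f => by
    classical
    induction (Finset.univ : Finset (Fin n)) using Finset.induction_on with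
    | empty => simp
    | insert a s ha ih => simp [Finset.sum_insert ha, ih]
  rw [this]
  refine Finset.sum_congr rfl fun i _ => ?_
  simp

lemma dot_star {n : ℕ} (x y : Fin n → ℍ[ℝ]) : star (star x ⬝ᵥ y) = star y ⬝ᵥ x := by
  simp [dotProduct, star_sum]

lemma dot_self {n : ℕ} (x : Fin n → ℍ[ℝ]) :
    star x ⬝ᵥ x = ((∑ i, ‖x i‖ ^ 2 : ℝ) : ℍ[ℝ]) := by
  simp only [dotProduct, Pi.star_apply, Quaternion.star_mul_self, Quaternion.normSq_eq_norm_mul_self]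
  rw [← Quaternion.algebraMap_def, map_sum]
  refine Finset.sum_congr rfl fun i _ => by rw [Quaternion.algebraMap_def, pow_two]

lemma exists_unit {n : ℕ} (x : Fin n → ℍ[ℝ]) (hx : x ≠ 0) :
    ∃ c : ℝ, star (c • x) ⬝ᵥ (c • x) = 1 := by
  have h : 0 < ∑ i, ‖x i‖ ^ 2 := by
    obtain ⟨i, hi⟩ := Function.ne_iff.mp hx
    refine Finset.sum_pos' (fun i _ => by positivity) ⟨i, Finset.mem_univ _, ?_⟩
    have : 0 < ‖x i‖ := norm_pos_iff.mpr hi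
    positivity
  refine ⟨(√(∑ i, ‖x i‖ ^ 2))⁻¹, ?_⟩
  have h2 := Real.sq_sqrt h.le
  have h3 := Real.sqrt_pos.mpr h
  rw [dot_self]
  simp only [Pi.smul_apply, norm_smul, mul_pow, ← Finset.mul_sum]
  rw [← Quaternion.coe_one]
  congr 1
  simp only [norm_inv, Real.norm_eq_abs, abs_of_pos h3, inv_pow, h2]
  field_simp

/-- `x ↦ (⟨v i, x⟩)ᵢ` as a real-linear map. -/
noncomputable def dotL {n k : ℕ} (v : Fin k → Fin n → ℍ[ℝ]) : (Fin n → ℍ[ℝ]) →ₗ[ℝ] (Fin k → ℍ[ℝ]) where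
  toFun x i := star (v i) ⬝ᵥ x
  map_add' x y := by ext1 i; simp [dotProduct_add]
  map_smul' c x := by ext1 i; simp [dotProduct_smul]

lemma exists_ker {n k : ℕ} (hk : k < n) (v : Fin k → Fin n → ℍ[ℝ]) :
    ∃ x, x ≠ 0 ∧ ∀ i, star (v i) ⬝ᵥ x = 0 := by
  have h : LinearMap.ker (dotL v) ≠ ⊥ := by
    apply LinearMap.ker_ne_bot_of_finrank_lt
    simp [Module.finrank_pi_fintype, Quaternion.finrank_eq_four]
    omega
  obtain ⟨x, hx, hx0⟩ := (Submodule.ne_bot_iff _).mp h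
  exact ⟨x, hx0, fun i => congrFun (LinearMap.mem_ker.mp hx) i⟩

/-- `x ↦ T x` as a real-linear map. -/
noncomputable def mulL {n : ℕ} (T : Matrix (Fin n) (Fin n) ℍ[ℝ]) :
    PiLp 2 (fun _ : Fin n => ℍ[ℝ]) →ₗ[ℝ] PiLp 2 (fun _ : Fin n => ℍ[ℝ]) where
  toFun x := WithLp.toLp 2 (T *ᵥ x.ofLp)
  map_add' x y := by simp [mulVec_add]
  map_smul' c x := by simp [mulVec_smul]

lemma dot_mulVec {m n : ℕ} (Q : Matrix (Fin m) (Fin n) ℍ[ℝ]) (x : Fin m → ℍ[ℝ]) (y : Fin n → ℍ[ℝ]) :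
    star x ⬝ᵥ (Q *ᵥ y) = star (Qᴴ *ᵥ x) ⬝ᵥ y := by
  rw [star_mulVec, conjTranspose_conjTranspose, dotProduct_mulVec]

lemma star_smul_vec {n : ℕ} (c : ℝ) (x : Fin n → ℍ[ℝ]) : star (c • x) = c • star x := by
  ext1 i
  simp [Quaternion.star_smul]

lemma exists_eig {n k : ℕ} (T : Matrix (Fin n) (Fin n) ℍ[ℝ]) (hT : Tᴴ = T) (hk : k < n)
    (v : Fin k → Fin n → ℍ[ℝ]) (s : Fin k → ℝ) (hv : ∀ i, T *ᵥ v i = s i • v i) :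
    ∃ (x : Fin n → ℍ[ℝ]) (c : ℝ), star x ⬝ᵥ x = 1 ∧ (∀ i, star (v i) ⬝ᵥ x = 0) ∧ T *ᵥ x = c • x := by
  let W : Submodule ℝ (PiLp 2 (fun _ : Fin n => ℍ[ℝ])) :=
    (LinearMap.ker (dotL v)).comap (WithLp.linearEquiv 2 ℝ (Fin n → ℍ[ℝ])).toLinearMap
  have hW : ∀ x, x ∈ W ↔ ∀ i, star (v i) ⬝ᵥ x.ofLp = 0 := fun x => by
    simp only [W, Submodule.mem_comap, LinearMap.mem_ker, funext_iff]
    rfl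
  have hinv : ∀ x ∈ W, mulL T x ∈ W := by
    intro x hx
    rw [hW] at hx ⊢
    intro i
    change star (v i) ⬝ᵥ (T *ᵥ x.ofLp) = 0
    rw [dot_mulVec, hT, hv, star_smul_vec, smul_dotProduct, hx i, smul_zero]
  have hsym : (mulL T).IsSymmetric := by
    intro x y
    change inner ℝ (WithLp.toLp 2 (T *ᵥ x.ofLp)) (WithLp.toLp 2 y.ofLp) =
      inner ℝ (WithLp.toLp 2 x.ofLp) (WithLp.toLp 2 (T *ᵥ y.ofLp))
    rw [← re_dot, ← re_dot, dot_mulVec, hT]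
  have hsymW := hsym.restrict_invariant hinv
  obtain ⟨x0, hx0, hx0'⟩ := exists_ker hk v
  have : Nontrivial W := by
    refine (Submodule.nontrivial_iff_ne_bot).mpr ((Submodule.ne_bot_iff _).mpr
      ⟨WithLp.toLp 2 x0, (hW _).mpr hx0', ?_⟩)
    simpa using hx0
  obtain ⟨x, hx⟩ := (hsymW.hasEigenvalue_iSup_of_finiteDimensional).exists_hasEigenvector
  generalize (⨆ x : { x : W // x ≠ 0 }, _ : ℝ) = c at hx
  have h1 := congrArg (fun z : W => (z : PiLp 2 (fun _ : Fin n => ℍ[ℝ])).ofLp) hx.apply_eq_smul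
  have h1' : T *ᵥ (x : PiLp 2 (fun _ : Fin n => ℍ[ℝ])).ofLp
      = c • (x : PiLp 2 (fun _ : Fin n => ℍ[ℝ])).ofLp := h1
  have h2 : (x : PiLp 2 (fun _ : Fin n => ℍ[ℝ])).ofLp ≠ 0 := by
    have := hx.2
    intro h
    apply this
    ext1
    exact (WithLp.ofLp_eq_zero 2).mp h
  obtain ⟨a, ha⟩ := exists_unit _ h2
  refine ⟨_, c, ha, fun i => ?_, ?_⟩
  · rw [dotProduct_smul, (hW _).mp x.2 i, smul_zero]
  · rw [mulVec_smul, h1', smul_comm]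

/-- `u 0, …, u (k - 1)` are orthonormal for `⟨x, y⟩ = ∑ a, star (x a) * y a`. -/
def OrthoN {n : ℕ} (k : ℕ) (u : ℕ → Fin n → ℍ[ℝ]) : Prop :=
  ∀ i < k, ∀ j < k, star (u i) ⬝ᵥ u j = if i = j then 1 else 0

lemma OrthoN.snoc {n k : ℕ} {u : ℕ → Fin n → ℍ[ℝ]} (hu : OrthoN k u) {x : Fin n → ℍ[ℝ]}
    (hx : star x ⬝ᵥ x = 1) (hux : ∀ i < k, star (u i) ⬝ᵥ x = 0) :
    OrthoN (k + 1) (Function.update u k x) := by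
  intro i hi j hj
  rcases eq_or_ne i k with rfl | hik <;> rcases eq_or_ne j i with rfl | hji
  · simpa using hx
  · have : j < i := by omega
    simp only [Function.update_self, Function.update_of_ne hji, hji.symm, if_false]
    rw [← dot_star, hux j this, star_zero]
  · simp only [Function.update_of_ne hik]
    exact (hu j (by omega) j (by omega)).trans (by simp)
  · rcases eq_or_ne j k with rfl | hjk
    · simp only [Function.update_self, Function.update_of_ne hik, hji.symm, if_false]
      exact hux i (by omega)
    · simp only [Function.update_of_ne hik, Function.update_of_ne hjk]
      exact hu i (by omega) j (by omega)

lemma OrthoN.extend {n k l : ℕ} {u : ℕ → Fin n → ℍ[ℝ]} (hu : OrthoN k u) (hkl : k ≤ l)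
    (hl : l ≤ n) : ∃ u' : ℕ → Fin n → ℍ[ℝ], OrthoN l u' ∧ ∀ i < k, u' i = u i := by
  induction l, hkl using Nat.le_induction with
  | base => exact ⟨u, hu, fun _ _ => rfl⟩
  | succ l hkl ih =>
    obtain ⟨w, hw, hwu⟩ := ih (by omega)
    obtain ⟨x, hx, hx'⟩ := exists_ker (show l < n by omega) (fun i : Fin l => w i)
    obtain ⟨c, hc⟩ := exists_unit x hx
    refine ⟨_, hw.snoc hc fun i hi => ?_, fun i hi => ?_⟩
    · rw [dotProduct_smul, hx' ⟨i, hi⟩, smul_zero]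
    · rw [Function.update_of_ne (by omega), hwu i hi]

lemma OrthoN.le {n k : ℕ} {u : ℕ → Fin n → ℍ[ℝ]} (hu : OrthoN k u) : k ≤ n := by
  by_contra! h
  let A : Matrix (Fin n) (Fin k) ℍ[ℝ] := of fun a i => u i a
  have hA : Aᴴ * A = 1 := by
    ext1 i j
    rw [one_apply]
    have := hu i i.2 j j.2
    simp only [Fin.val_inj] at this
    exact this
  let L : (Fin k → ℍ[ℝ]) →ₗ[ℝ] (Fin n → ℍ[ℝ]) :=
    { toFun := fun x => A *ᵥ x
      map_add' := fun x y => mulVec_add _ _ _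
      map_smul' := fun c x => mulVec_smul _ _ _ }
  have hL : LinearMap.ker L ≠ ⊥ := by
    apply LinearMap.ker_ne_bot_of_finrank_lt
    simp [Module.finrank_pi_fintype, Quaternion.finrank_eq_four]
    omega
  obtain ⟨x, hx, hx0⟩ := (Submodule.ne_bot_iff _).mp hL
  apply hx0
  have : A *ᵥ x = 0 := hx
  rw [← one_mulVec x, ← hA, ← mulVec_mulVec, this, mulVec_zero]

lemma exists_eigs {n : ℕ} (T : Matrix (Fin n) (Fin n) ℍ[ℝ]) (hT : Tᴴ = T) (k : ℕ) (hk : k ≤ n) :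
    ∃ (v : ℕ → Fin n → ℍ[ℝ]) (s : ℕ → ℝ), OrthoN k v ∧ ∀ i < k, T *ᵥ v i = s i • v i := by
  induction k with
  | zero => exact ⟨0, 0, fun i hi => by omega, fun i hi => by omega⟩
  | succ k ih =>
    obtain ⟨v, s, hv, hs⟩ := ih (by omega)
    obtain ⟨x, c, hx, hvx, hc⟩ := exists_eig T hT (show k < n by omega) (fun i : Fin k => v i)
      (fun i => s i) (fun i => hs i i.2)
    refine ⟨_, Function.update s k c, hv.snoc hx fun i hi => hvx ⟨i, hi⟩, fun i hi => ?_⟩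
    rcases eq_or_ne i k with rfl | hik
    · simpa using hc
    · simp only [Function.update_of_ne hik]
      exact hs i (by omega)

/-- The `m × n` matrix with the real numbers `σ 0, σ 1, …` on its main diagonal and zeros
elsewhere. -/
noncomputable def rectDiag {m n : ℕ} (σ : Fin (min m n) → ℝ) : Matrix (Fin m) (Fin n) ℍ[ℝ] :=
  of fun i j => if h : i.1 = j.1 then ((σ ⟨i.1, by omega⟩ : ℝ) : ℍ[ℝ]) else 0

/-- `σ` is the list of singular values of `Q`, in decreasing order (zeros included): there is a
quaternion singular value decomposition `Q = A D Bᴴ`, with `A`, `B` unitary and `D` the rectangular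
diagonal matrix with diagonal `σ`. -/
structure IsSingularValues {m n : ℕ} (Q : Matrix (Fin m) (Fin n) ℍ[ℝ]) (σ : Fin (min m n) → ℝ) : Prop where
  nonneg : ∀ k, 0 ≤ σ k
  antitone : Antitone σ
  exists_qsvd : ∃ A ∈ unitary (Matrix (Fin m) (Fin m) ℍ[ℝ]), ∃ B ∈ unitary (Matrix (Fin n) (Fin n) ℍ[ℝ]),
    Q = A * rectDiag σ * Bᴴ

lemma OrthoN.unitary {n : ℕ} {u : ℕ → Fin n → ℍ[ℝ]} (hu : OrthoN n u) :
    (of fun a (i : Fin n) => u i a : Matrix (Fin n) (Fin n) ℍ[ℝ]) ∈ unitary (Matrix (Fin n) (Fin n) ℍ[ℝ]) := by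
  set A : Matrix (Fin n) (Fin n) ℍ[ℝ] := of fun a i => u i a
  have hA : Aᴴ * A = 1 := by
    ext1 i j
    rw [one_apply]
    have := hu i i.2 j j.2
    simp only [Fin.val_inj] at this
    exact this
  exact ⟨hA, mul_eq_one_comm.mp hA⟩

/-- Every quaternion matrix has a singular value decomposition. -/
theorem exists_isSingularValues {m n : ℕ} (Q : Matrix (Fin m) (Fin n) ℍ[ℝ]) : ∃ σ, IsSingularValues Q σ := by
  obtain ⟨v0, s0, hv0, hs0⟩ := exists_eigs (Qᴴ * Q) (by simp) n le_rfl
  -- sort the eigenvalues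
  let p : Equiv.Perm (Fin n) := Tuple.sort (fun i : Fin n => - s0 i)
  have hp : Antitone (fun i : Fin n => s0 (p i)) := by
    have := Tuple.monotone_sort (fun i : Fin n => - s0 i)
    intro i j hij
    have := this hij
    simpa using this
  let v : ℕ → Fin n → ℍ[ℝ] := fun i => if h : i < n then v0 (p ⟨i, h⟩) else 0
  let s : ℕ → ℝ := fun i => if h : i < n then s0 (p ⟨i, h⟩) else 0
  have hv : OrthoN n v := by
    intro i hi j hj
    simp only [v, hi, hj, dif_pos]
    rw [hv0 _ (p _).2 _ (p _).2]
    simp [Fin.val_inj]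
  have hs : ∀ i < n, (Qᴴ * Q) *ᵥ v i = s i • v i := by
    intro i hi
    simp only [v, s, hi, dif_pos]
    exact hs0 _ (p _).2
  have hanti : ∀ i j, i ≤ j → j < n → s j ≤ s i := by
    intro i j hij hj
    simp only [s, hj, lt_of_le_of_lt hij hj, dif_pos]
    exact hp (show (⟨i, _⟩ : Fin n) ≤ ⟨j, _⟩ from hij)
  have hQ : ∀ i < n, ∀ j < n, star (Q *ᵥ v i) ⬝ᵥ (Q *ᵥ v j) = if i = j then ((s j : ℝ) : ℍ[ℝ]) else 0 := by
    intro i hi j hj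
    have h := dot_mulVec Qᴴ (v i) (Q *ᵥ v j)
    rw [conjTranspose_conjTranspose] at h
    rw [← h, mulVec_mulVec, hs j hj, dotProduct_smul, hv i hi j hj]
    split_ifs
    · rw [← Quaternion.coe_one, ← Quaternion.coe_smul, smul_eq_mul, mul_one]
    · simp
  have hs_nonneg : ∀ i < n, 0 ≤ s i := by
    intro i hi
    have h := hQ i hi i hi
    rw [dot_self, if_pos rfl] at h
    rw [← Quaternion.coe_injective h]
    positivity
  have hex : ∃ r, r = n ∨ s r ≤ 0 := ⟨n, Or.inl rfl⟩
  classical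
  let r := Nat.find hex
  have hr_n : r ≤ n := Nat.find_min' hex (Or.inl rfl)
  have hlt : ∀ i < r, 0 < s i := fun i hi => by
    have := Nat.find_min hex hi
    push Not at this
    exact this.2
  have hge : ∀ i, r ≤ i → i < n → s i = 0 := fun i hi hin => by
    refine le_antisymm ?_ (hs_nonneg i hin)
    rcases Nat.find_spec hex with h | h
    · change r = n at h
      omega
    · exact (hanti r i hi hin).trans h
  let u0 : ℕ → Fin m → ℍ[ℝ] := fun i => (√(s i))⁻¹ • (Q *ᵥ v i)
  have hu0 : OrthoN r u0 := by
    intro i hi j hj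
    simp only [u0]
    rw [star_smul_vec, smul_dotProduct, dotProduct_smul, hQ i (by omega) j (by omega)]
    split_ifs with h
    · subst h
      have h1 := Real.sqrt_pos.mpr (hlt i hi)
      have h2 := Real.mul_self_sqrt (hlt i hi).le
      rw [← Quaternion.coe_smul, ← Quaternion.coe_smul, ← Quaternion.coe_one]
      congr 1
      simp only [smul_eq_mul]
      field_simp
      nlinarith
    · simp
  have hrm := hu0.le
  obtain ⟨u, hu, huu0⟩ := hu0.extend hrm le_rfl
  have hQv : ∀ i < n, Q *ᵥ v i = if i < r then √(s i) • u i else 0 := by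
    intro i hi
    split_ifs with h
    · rw [huu0 i h]
      simp only [u0]
      rw [smul_smul, mul_inv_cancel₀ (Real.sqrt_pos.mpr (hlt i h)).ne', one_smul]
    · have h1 := hQ i hi i hi
      rw [if_pos rfl, hge i (by omega) hi, dot_self] at h1
      have h2 := Quaternion.coe_injective h1
      ext1 a
      have h3 := (Finset.sum_eq_zero_iff_of_nonneg (fun i _ => by positivity)).mp h2 a (Finset.mem_univ a)
      simpa using h3
  refine ⟨fun k => √(s k), fun k => Real.sqrt_nonneg _,
    fun i j hij => Real.sqrt_le_sqrt (hanti i j hij (by omega)),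
    _, hu.unitary, _, hv.unitary, ?_⟩
  set A : Matrix (Fin m) (Fin m) ℍ[ℝ] := of fun a i => u i a
  have hB := hv.unitary
  set B : Matrix (Fin n) (Fin n) ℍ[ℝ] := of fun a i => v i a
  have key : Q * B = A * rectDiag (fun k : Fin (min m n) => √(s k)) := by
    ext1 a j
    have h1 : (Q * B) a j = (Q *ᵥ v j) a := rfl
    rw [h1, hQv j j.2, mul_apply]
    by_cases hjm : j.1 < m
    · rw [Finset.sum_eq_single ⟨j.1, hjm⟩]
      · simp only [A, rectDiag, of_apply, dif_pos]
        split_ifs with h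
        · simp [Quaternion.mul_coe_eq_smul]
        · simp [hge j (by omega) j.2]
      · intro b _ hb
        have : b.1 ≠ j.1 := fun h => hb (Fin.ext h)
        simp [rectDiag, this]
      · simp
    · rw [if_neg (by omega), Finset.sum_eq_zero]
      · rfl
      · intro b _
        have : b.1 ≠ j.1 := by omega
        simp [rectDiag, this]
  rw [← key, Matrix.mul_assoc]
  have : B * Bᴴ = 1 := hB.2
  rw [this, Matrix.mul_one]

/-- The singular values are unique. -/
theorem IsSingularValues.unique {m n : ℕ} {Q : Matrix (Fin m) (Fin n) ℍ[ℝ]} {σ τ : Fin (min m n) → ℝ}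
    (hσ : IsSingularValues Q σ) (hτ : IsSingularValues Q τ) : σ = τ := by
  obtain ⟨A, hA, B, hB, hQ⟩ := hσ.exists_qsvd
  obtain ⟨C, hC, D, hD, hQ'⟩ := hτ.exists_qsvd
  let pad : (Fin (min m n) → ℝ) → Fin n → ℝ := fun ρ j => if h : j.1 < m then ρ ⟨j, by omega⟩ else 0
  have hgram : ∀ ρ : Fin (min m n) → ℝ, (rectDiag ρ : Matrix (Fin m) (Fin n) ℍ[ℝ])ᴴ * rectDiag ρ
      = diagonal fun j => ((pad ρ j ^ 2 : ℝ) : ℍ[ℝ]) := by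
    intro ρ
    ext1 i j
    rw [mul_apply, diagonal_apply]
    by_cases him : i.1 < m
    · rw [Finset.sum_eq_single ⟨i.1, him⟩]
      · by_cases hij : i = j
        · subst hij
          simp [rectDiag, pad, him, pow_two]
        · have : i.1 ≠ j.1 := fun h => hij (Fin.ext h)
          simp [rectDiag, hij, this]
      · intro b _ hb
        have : b.1 ≠ i.1 := fun h => hb (Fin.ext h)
        simp [rectDiag, this]
      · simp
    · rw [Finset.sum_eq_zero]
      · simp [pad, him]
      · intro b _
        have : b.1 ≠ i.1 := by omega
        simp [rectDiag, this]
  have hA' : Aᴴ * A = 1 := hA.1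
  have hC' : Cᴴ * C = 1 := hC.1
  have hB' : Bᴴ * B = 1 := hB.1
  have hD' : Dᴴ * D = 1 := hD.1
  have hB'' : B * Bᴴ = 1 := hB.2
  have hD'' : D * Dᴴ = 1 := hD.2
  have e1 : Qᴴ * Q * B = B * diagonal fun j => ((pad σ j ^ 2 : ℝ) : ℍ[ℝ]) := by
    rw [← hgram, hQ]
    simp only [conjTranspose_mul, conjTranspose_conjTranspose, Matrix.mul_assoc, hB', Matrix.mul_one]
    rw [← Matrix.mul_assoc Aᴴ A, hA', Matrix.one_mul]
  have e2 : Dᴴ * (Qᴴ * Q) = (diagonal fun j => ((pad τ j ^ 2 : ℝ) : ℍ[ℝ])) * Dᴴ := by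
    rw [← hgram, hQ']
    simp only [conjTranspose_mul, conjTranspose_conjTranspose, ← Matrix.mul_assoc, hD', Matrix.one_mul]
    rw [Matrix.mul_assoc _ Cᴴ C, hC', Matrix.mul_one]
  set P := Dᴴ * B with hP
  have hPP : Pᴴ * P = 1 := by
    rw [hP, conjTranspose_mul, conjTranspose_conjTranspose, Matrix.mul_assoc, ← Matrix.mul_assoc D,
      hD'', Matrix.one_mul, hB']
  have hPP' : P * Pᴴ = 1 := mul_eq_one_comm.mp hPP
  have hcomm : ∀ i j, P i j ≠ 0 → pad σ j ^ 2 = pad τ i ^ 2 := by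
    intro i j hne
    have h : P * (diagonal fun j => ((pad σ j ^ 2 : ℝ) : ℍ[ℝ]))
        = (diagonal fun j => ((pad τ j ^ 2 : ℝ) : ℍ[ℝ])) * P := by
      rw [hP, Matrix.mul_assoc, ← e1, ← Matrix.mul_assoc (diagonal _), ← e2]
      simp only [Matrix.mul_assoc]
    have h' := congrFun (congrFun h i) j
    rw [mul_diagonal, diagonal_mul, ← Quaternion.coe_commutes] at h'
    exact Quaternion.coe_injective (mul_right_cancel₀ hne h')
  have hcol : ∀ j, ∑ i, ‖P i j‖ ^ 2 = 1 := by
    intro j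
    have h := congrFun (congrFun hPP j) j
    rw [one_apply_eq] at h
    have h2 := dot_self (fun i => P i j)
    have h3 : star (fun i => P i j) ⬝ᵥ (fun i => P i j) = 1 := h
    rw [h3, ← Quaternion.coe_one] at h2
    exact (Quaternion.coe_injective h2).symm
  have hrow : ∀ i, ∑ j, ‖P i j‖ ^ 2 = 1 := by
    intro i
    have h := congrFun (congrFun hPP' i) i
    rw [one_apply_eq] at h
    have h2 := dot_self (fun j => star (P i j))
    have h3 : star (fun j => star (P i j)) ⬝ᵥ (fun j => star (P i j)) = 1 := by
      rw [← h]
      simp [dotProduct, mul_apply]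
    rw [h3, ← Quaternion.coe_one] at h2
    simpa using (Quaternion.coe_injective h2).symm
  have hcard : ∀ c : ℝ, (Finset.univ.filter fun j => c ≤ pad σ j ^ 2).card
      = (Finset.univ.filter fun j => c ≤ pad τ j ^ 2).card := by
    intro c
    have h1 : ∀ i j, (if c ≤ pad σ j ^ 2 then ‖P i j‖ ^ 2 else 0)
        = if c ≤ pad τ i ^ 2 then ‖P i j‖ ^ 2 else 0 := by
      intro i j
      by_cases h : P i j = 0
      · simp [h]
      · rw [hcomm i j h]
    have h2 : ∑ j, ∑ i, (if c ≤ pad σ j ^ 2 then ‖P i j‖ ^ 2 else 0)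
        = ∑ i, ∑ j, if c ≤ pad τ i ^ 2 then ‖P i j‖ ^ 2 else 0 := by
      rw [Finset.sum_comm]
      exact Finset.sum_congr rfl fun i _ => Finset.sum_congr rfl fun j _ => h1 i j
    have h3 : ∀ j, (∑ i, if c ≤ pad σ j ^ 2 then ‖P i j‖ ^ 2 else 0)
        = if c ≤ pad σ j ^ 2 then 1 else 0 := fun j => by
      split_ifs
      · exact hcol j
      · simp
    have h4 : ∀ i, (∑ j, if c ≤ pad τ i ^ 2 then ‖P i j‖ ^ 2 else 0)
        = if c ≤ pad τ i ^ 2 then 1 else 0 := fun i => by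
      split_ifs
      · exact hrow i
      · simp
    simp only [h3, h4, Finset.sum_boole] at h2
    exact_mod_cast h2
  have hmono : ∀ ρ : Fin (min m n) → ℝ, (∀ k, 0 ≤ ρ k) → Antitone ρ →
      Antitone fun j => pad ρ j ^ 2 := by
    intro ρ h0 h1 i j hij
    have hij' : i.1 ≤ j.1 := hij
    simp only [pad]
    by_cases hj : j.1 < m
    · have hi : i.1 < m := by omega
      simp only [hi, hj, dif_pos]
      exact pow_le_pow_left₀ (h0 _) (h1 hij) 2
    · rw [dif_neg hj, zero_pow two_ne_zero]
      exact sq_nonneg _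
  have aux : ∀ f g : Fin n → ℝ, Antitone f → Antitone g →
      (∀ c : ℝ, (Finset.univ.filter fun j => c ≤ f j).card
        = (Finset.univ.filter fun j => c ≤ g j).card) → ∀ i, g i ≤ f i := by
    intro f g hf hg hc i
    by_contra! hlt
    have h1 : Finset.Iic i ⊆ Finset.univ.filter fun j => g i ≤ g j := by
      intro j hj
      simpa using hg (Finset.mem_Iic.mp hj)
    have h2 : (Finset.univ.filter fun j => g i ≤ f j) ⊆ Finset.Iio i := by
      intro j hj
      rw [Finset.mem_Iio]
      by_contra! h
      have := (Finset.mem_filter.mp hj).2.trans (hf h)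
      linarith
    have h3 := Finset.card_le_card h1
    have h4 := Finset.card_le_card h2
    rw [hc] at h4
    simp only [Fin.card_Iic, Fin.card_Iio] at h3 h4
    omega
  have mσ := hmono σ hσ.nonneg hσ.antitone
  have mτ := hmono τ hτ.nonneg hτ.antitone
  ext1 k
  have hk : k.1 < n := by omega
  have hkm : k.1 < m := by omega
  have h : pad σ ⟨k, hk⟩ ^ 2 = pad τ ⟨k, hk⟩ ^ 2 :=
    le_antisymm (aux _ _ mτ mσ (fun c => (hcard c).symm) _) (aux _ _ mσ mτ hcard _)
  simp only [pad, hkm, dif_pos] at h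
  exact (pow_left_inj₀ (hσ.nonneg k) (hτ.nonneg k) two_ne_zero).mp h

/-- The singular values `σ₁(Q) ≥ σ₂(Q) ≥ …` of the `m × n` quaternion matrix `Q`, the
`min m n` diagonal entries in its singular value decomposition. -/
noncomputable def singularValues {m n : ℕ} (Q : Matrix (Fin m) (Fin n) ℍ[ℝ]) :
    Fin (min m n) → ℝ :=
  (exists_isSingularValues Q).choose

theorem isSingularValues_singularValues {m n : ℕ} (Q : Matrix (Fin m) (Fin n) ℍ[ℝ]) :
    IsSingularValues Q (singularValues Q) :=
  (exists_isSingularValues Q).choose_spec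

/-- The Schatten-`p` (quasi-)norm of a quaternion matrix, for `0 < p < ∞`. -/
noncomputable def schattenNorm {m n : ℕ} (p : ℝ) (Q : Matrix (Fin m) (Fin n) ℍ[ℝ]) : ℝ :=
  (∑ k, singularValues Q k ^ p) ^ (1 / p)

/-- The nuclear norm of a quaternion matrix. -/
noncomputable def nuclearNorm {m n : ℕ} (Q : Matrix (Fin m) (Fin n) ℍ[ℝ]) : ℝ :=
  schattenNorm 1 Q

/-- The Frobenius norm of a quaternion matrix. -/
noncomputable def frobeniusNorm {m n : ℕ} (Q : Matrix (Fin m) (Fin n) ℍ[ℝ]) : ℝ :=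
  √(∑ i, ∑ j, ‖Q i j‖ ^ 2)

/-- The rank of a quaternion matrix: the dimension of its column space as a right `ℍ`-module
(over the noncommutative `ℍ` the left span of the columns would be the wrong space). -/
noncomputable def rank {m n : ℕ} (Q : Matrix (Fin m) (Fin n) ℍ[ℝ]) : ℕ :=
  Module.finrank ℍ[ℝ]ᵐᵒᵖ (Submodule.span ℍ[ℝ]ᵐᵒᵖ (Set.range Q.col))

/-- The values `[(‖U‖_F² + 2 ‖V‖_*) / 3]^(3/2)` over all factorizations `X = U Vᴴ` through `d`
columns. -/
def fnnValues {M N : ℕ} (d : ℕ) (X : Matrix (Fin M) (Fin N) ℍ[ℝ]) : Set ℝ :=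
  {t | ∃ (U : Matrix (Fin M) (Fin d) ℍ[ℝ]) (V : Matrix (Fin N) (Fin d) ℍ[ℝ]), X = U * Vᴴ ∧
    t = ((frobeniusNorm U ^ 2 + 2 * nuclearNorm V) / 3) ^ (3 / 2 : ℝ)}

/-- The quaternion Frobenius/nuclear norm. It is written as an infimum; that the infimum is a
minimum is part of the theorem about it. -/
noncomputable def fnn {M N : ℕ} (d : ℕ) (X : Matrix (Fin M) (Fin N) ℍ[ℝ]) : ℝ :=
  sInf (fnnValues d X)

end QuaternionMatrix

namespace QuaternionMatrix

/-! Lower bound. Let `X = U Vᴴ` and `V = C T Eᴴ` be a singular value decomposition with diagonal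
`τ`. Then `X C = (U E) Tᴴ`, so column `j` of `X C` is column `j` of `U E` scaled by `τ j`, with
squared norm `τ j ^ 2 * w j`, where the `w j` sum to `‖U‖_F²`. The squared column norms of `X C` are
also averages of the squared singular values of `X`, the weights being the squared moduli of the
entries of a unitary matrix. These weights are doubly stochastic, so concavity of `t ^ (1/3)` gives
`∑ σ ^ (2/3) ≤ ∑ (τ j ^ 2 * w j) ^ (1/3)` (`sum_rpow_le_sum_col`), and weighted AM-GM bounds each
term by `(w j + 2 * τ j) / 3` (`rpow_third_le`). Testing in the basis `C` makes any general
inequality for singular values of products unnecessary.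

Attainment. If `X = A D Bᴴ`, the factors `A D^(1/3)` and `B D^(2/3)` give equality. They fit into
`d` columns because the singular values of index at least `d` vanish when the rank is at most `d`
(`IsSingularValues.zeroExtend_eq_zero`). -/

/-! ### Zero padding, to compare diagonals of matrices of different shapes -/

lemma sum_castLE_eq {l m : ℕ} (h : l ≤ m) (g : Fin m → ℝ) (hg : ∀ i : Fin m, l ≤ i.1 → g i = 0) :
    ∑ k : Fin l, g (Fin.castLE h k) = ∑ i, g i := by
  refine Fintype.sum_of_injective (Fin.castLE h) (Fin.castLE_injective h) _ _ (fun i hi => ?_)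
    fun _ => rfl
  refine hg i ?_
  by_contra! hlt
  exact hi ⟨⟨i.1, hlt⟩, rfl⟩

lemma sum_castLE_le {l m : ℕ} (h : l ≤ m) (g : Fin m → ℝ) (hg : ∀ i, 0 ≤ g i) :
    ∑ k : Fin l, g (Fin.castLE h k) ≤ ∑ i, g i := by
  have := Finset.sum_map Finset.univ (Fin.castLEEmb h) g
  simp only [Fin.coe_castLEEmb] at this
  rw [← this]
  exact Finset.sum_le_univ_sum_of_nonneg hg

/-- The extension of a finite sequence by zeros. -/
noncomputable def zeroExtend {l : ℕ} (σ : Fin l → ℝ) (k : ℕ) : ℝ :=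
  if h : k < l then σ ⟨k, h⟩ else 0

lemma zeroExtend_of_le {l k : ℕ} (σ : Fin l → ℝ) (h : l ≤ k) : zeroExtend σ k = 0 :=
  dif_neg (by omega)

@[simp] lemma zeroExtend_val {l : ℕ} (σ : Fin l → ℝ) (k : Fin l) : zeroExtend σ k = σ k :=
  dif_pos k.2

lemma zeroExtend_nonneg {l : ℕ} {σ : Fin l → ℝ} (hσ : ∀ k, 0 ≤ σ k) (k : ℕ) :
    0 ≤ zeroExtend σ k := by
  unfold zeroExtend
  split_ifs
  exacts [hσ _, le_rfl]

lemma zeroExtend_antitone {l : ℕ} {σ : Fin l → ℝ} (hσ : ∀ k, 0 ≤ σ k) (h : Antitone σ) :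
    Antitone (zeroExtend σ) := by
  intro i j hij
  by_cases hj : j < l
  · have hi : i < l := by omega
    simp only [zeroExtend, hi, hj, dif_pos]
    exact h (show (⟨i, hi⟩ : Fin l) ≤ ⟨j, hj⟩ from hij)
  · rw [zeroExtend_of_le σ (by omega)]
    exact zeroExtend_nonneg hσ i

lemma sum_zeroExtend {l m : ℕ} (h : l ≤ m) (σ : Fin l → ℝ) (f : ℝ → ℝ) (hf : f 0 = 0) :
    ∑ i : Fin m, f (zeroExtend σ i) = ∑ k, f (σ k) := by
  rw [← sum_castLE_eq h]
  · simp
  · intro i hi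
    rw [zeroExtend_of_le σ hi, hf]

lemma rectDiag_apply {m n : ℕ} (σ : Fin (min m n) → ℝ) (i : Fin m) (j : Fin n) :
    (rectDiag σ : Matrix (Fin m) (Fin n) ℍ[ℝ]) i j
      = if i.1 = j.1 then ((zeroExtend σ i.1 : ℝ) : ℍ[ℝ]) else 0 := by
  simp only [rectDiag, of_apply]
  split_ifs with h
  · rw [zeroExtend, dif_pos]
  · rfl

/-! ### Unitary invariance of column, row and Frobenius norms -/

lemma sum_norm_sq_mulVec {m n : ℕ} {A : Matrix (Fin m) (Fin n) ℍ[ℝ]} (hA : Aᴴ * A = 1)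
    (x : Fin n → ℍ[ℝ]) : ∑ i, ‖(A *ᵥ x) i‖ ^ 2 = ∑ i, ‖x i‖ ^ 2 := by
  have h := dot_mulVec A (A *ᵥ x) x
  rw [mulVec_mulVec, hA, one_mulVec, dot_self, dot_self] at h
  exact Quaternion.coe_injective h

lemma sum_norm_sq_col {n : ℕ} {P : Matrix (Fin n) (Fin n) ℍ[ℝ]}
    (hP : P ∈ unitary (Matrix (Fin n) (Fin n) ℍ[ℝ])) (j : Fin n) : ∑ i, ‖P i j‖ ^ 2 = 1 := by
  have h := sum_norm_sq_mulVec (show Pᴴ * P = 1 from hP.1) (Pi.single j 1)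
  have h1 : ∑ i, ‖(Pi.single j 1 : Fin n → ℍ[ℝ]) i‖ ^ 2 = 1 := by
    rw [Finset.sum_eq_single j (fun i _ hi => by simp [hi]) (by simp)]
    simp
  simpa [h1] using h

lemma sum_norm_sq_row {n : ℕ} {P : Matrix (Fin n) (Fin n) ℍ[ℝ]}
    (hP : P ∈ unitary (Matrix (Fin n) (Fin n) ℍ[ℝ])) (i : Fin n) : ∑ j, ‖P i j‖ ^ 2 = 1 := by
  simpa [star_eq_conjTranspose] using sum_norm_sq_col (Unitary.star_mem hP) i

lemma frobeniusNorm_sq {m n : ℕ} (Q : Matrix (Fin m) (Fin n) ℍ[ℝ]) :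
    frobeniusNorm Q ^ 2 = ∑ i, ∑ j, ‖Q i j‖ ^ 2 :=
  Real.sq_sqrt (by positivity)

lemma frobeniusNorm_conjTranspose {m n : ℕ} (Q : Matrix (Fin m) (Fin n) ℍ[ℝ]) :
    frobeniusNorm Qᴴ = frobeniusNorm Q := by
  rw [frobeniusNorm, frobeniusNorm, Finset.sum_comm]
  simp

lemma frobeniusNorm_isometry_mul {l m n : ℕ} {A : Matrix (Fin l) (Fin m) ℍ[ℝ]} (hA : Aᴴ * A = 1)
    (Q : Matrix (Fin m) (Fin n) ℍ[ℝ]) : frobeniusNorm (A * Q) = frobeniusNorm Q := by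
  rw [frobeniusNorm, frobeniusNorm, Finset.sum_comm, Finset.sum_comm (s := Finset.univ (α := Fin m))]
  congr 1
  exact Finset.sum_congr rfl fun j _ => sum_norm_sq_mulVec hA fun i => Q i j

lemma frobeniusNorm_mul_unitary {m n : ℕ} {E : Matrix (Fin n) (Fin n) ℍ[ℝ]}
    (hE : E ∈ unitary (Matrix (Fin n) (Fin n) ℍ[ℝ])) (Q : Matrix (Fin m) (Fin n) ℍ[ℝ]) :
    frobeniusNorm (Q * E) = frobeniusNorm Q := by
  rw [← frobeniusNorm_conjTranspose, conjTranspose_mul, frobeniusNorm_isometry_mul,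
    frobeniusNorm_conjTranspose]
  rw [conjTranspose_conjTranspose]
  exact hE.2

/-! ### Lower bound: column norms, concavity and AM-GM -/

/-- Column `j` of `Q (rectDiag τ)ᴴ` is column `j` of `Q` scaled by `τ j`. -/
lemma norm_sq_mul_conjTranspose_rectDiag {l m n : ℕ} (Q : Matrix (Fin l) (Fin n) ℍ[ℝ])
    (τ : Fin (min m n) → ℝ) (i : Fin l) (j : Fin m) :
    ‖(Q * (rectDiag τ)ᴴ) i j‖ ^ 2
      = if h : j.1 < n then zeroExtend τ j.1 ^ 2 * ‖Q i ⟨j.1, h⟩‖ ^ 2 else 0 := by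
  rw [mul_apply]
  split_ifs with h
  · rw [Finset.sum_eq_single ⟨j.1, h⟩]
    · simp [rectDiag_apply, mul_pow, mul_comm]
    · intro b _ hb
      have : j.1 ≠ b.1 := fun h => hb (Fin.ext h.symm)
      simp [rectDiag_apply, this]
    · simp
  · rw [Finset.sum_eq_zero]
    · simp
    · intro b _
      have : j.1 ≠ b.1 := by omega
      simp [rectDiag_apply, this]

/-- The squared norms of the columns of `A D Pᴴ` with `A` an isometry. -/
lemma sum_norm_sq_col_svd {m n : ℕ} {A : Matrix (Fin m) (Fin m) ℍ[ℝ]} (hA : Aᴴ * A = 1)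
    (P : Matrix (Fin n) (Fin n) ℍ[ℝ]) (σ : Fin (min m n) → ℝ) (j : Fin n) :
    ∑ i, ‖(A * rectDiag σ * Pᴴ) i j‖ ^ 2 = ∑ k : Fin n, ‖P j k‖ ^ 2 * zeroExtend σ k ^ 2 := by
  have h1 : ∑ i, ‖(A * rectDiag σ * Pᴴ) i j‖ ^ 2 = ∑ i, ‖(rectDiag σ * Pᴴ) i j‖ ^ 2 := by
    rw [Matrix.mul_assoc]
    exact sum_norm_sq_mulVec hA fun i => (rectDiag σ * Pᴴ) i j
  have h2 : ∀ i : Fin m, ‖(rectDiag σ * Pᴴ) i j‖ ^ 2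
      = if h : i.1 < n then zeroExtend σ i.1 ^ 2 * ‖P j ⟨i.1, h⟩‖ ^ 2 else 0 := by
    intro i
    rw [← norm_sq_mul_conjTranspose_rectDiag P σ j i, ← norm_star, ← conjTranspose_apply,
      conjTranspose_mul, conjTranspose_conjTranspose]
  -- One sum runs over `Fin m`, the other over `Fin n`; both reduce to the common initial segment of
  -- length `min m n`.
  rw [h1, Finset.sum_congr rfl fun i _ => h2 i, ← sum_castLE_eq (min_le_left m n),
    ← sum_castLE_eq (min_le_right m n)]
  · refine Finset.sum_congr rfl fun k _ => ?_
    have hk : k.1 < n := by omega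
    simp [hk, Fin.castLE, mul_comm]
  · intro k hk
    simp [zeroExtend_of_le σ hk]
  · intro i hi
    simp [zeroExtend_of_le σ hi]

/-- The sum of the powers `σ ^ (2 p)` of the singular values is at most the sum of the powers of the
column norms, in any orthonormal basis of the domain. -/
lemma sum_rpow_le_sum_col {m n : ℕ} {Q : Matrix (Fin m) (Fin n) ℍ[ℝ]} {σ : Fin (min m n) → ℝ}
    (hσ : IsSingularValues Q σ) {C : Matrix (Fin n) (Fin n) ℍ[ℝ]}
    (hC : C ∈ unitary (Matrix (Fin n) (Fin n) ℍ[ℝ])) {p : ℝ} (hp : 0 < p) (hp1 : p ≤ 1) :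
    ∑ k, σ k ^ (2 * p) ≤ ∑ j, (∑ i, ‖(Q * C) i j‖ ^ 2) ^ p := by
  obtain ⟨A, hA, B, hB, hQ⟩ := hσ.exists_qsvd
  have hP : Cᴴ * B ∈ unitary (Matrix (Fin n) (Fin n) ℍ[ℝ]) :=
    mul_mem (Unitary.star_mem hC) hB
  set P := Cᴴ * B with hPdef
  have hQC : Q * C = A * rectDiag σ * Pᴴ := by
    rw [hQ, hPdef, conjTranspose_mul, conjTranspose_conjTranspose]
    simp only [Matrix.mul_assoc]
  have hs := zeroExtend_nonneg hσ.nonneg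
  calc ∑ k, σ k ^ (2 * p) = ∑ k : Fin n, zeroExtend σ k ^ (2 * p) :=
        (sum_zeroExtend (min_le_right m n) σ (fun t => t ^ (2 * p))
          (Real.zero_rpow (by positivity))).symm
    _ = ∑ k : Fin n, (zeroExtend σ k ^ 2) ^ p := by
        refine Finset.sum_congr rfl fun k _ => ?_
        rw [← Real.rpow_natCast_mul (hs k)]
        norm_num
    -- The columns of `‖P j k‖ ^ 2` sum to 1, which inserts the weights for free.
    _ = ∑ j, ∑ k : Fin n, ‖P j k‖ ^ 2 * (zeroExtend σ k ^ 2) ^ p := by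
        rw [Finset.sum_comm]
        refine Finset.sum_congr rfl fun k _ => ?_
        rw [← Finset.sum_mul, sum_norm_sq_col hP, one_mul]
    _ ≤ ∑ j, (∑ i, ‖(Q * C) i j‖ ^ 2) ^ p := by
        refine Finset.sum_le_sum fun j _ => ?_
        rw [hQC, sum_norm_sq_col_svd hA.1]
        -- The rows sum to 1 as well, so Jensen applies for each fixed `j`.
        have := (Real.concaveOn_rpow hp.le hp1).le_map_sum (t := Finset.univ)
          (w := fun k => ‖P j k‖ ^ 2) (p := fun k : Fin n => zeroExtend σ k ^ 2)
          (fun _ _ => by positivity) (sum_norm_sq_row hP j)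
          (fun k _ => Set.mem_Ici.mpr (by positivity))
        simpa only [smul_eq_mul] using this

/-- AM-GM with weights 2/3 on `d` and 1/3 on `w`. This is where the coefficients of the
Frobenius/nuclear norm come from; equality holds when `d = w`. -/
lemma rpow_third_le {d w : ℝ} (hd : 0 ≤ d) (hw : 0 ≤ w) :
    (d ^ 2 * w) ^ (1 / 3 : ℝ) ≤ (w + 2 * d) / 3 := by
  have h := Real.geom_mean_le_arith_mean2_weighted (w₁ := 2 / 3) (w₂ := 1 / 3) (by norm_num)
    (by norm_num) hd hw (by norm_num)
  rw [Real.mul_rpow (by positivity) hw, ← Real.rpow_natCast_mul hd]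
  norm_num at h ⊢
  linarith

/-- By uniqueness, any decomposition at hand computes the norm, not only the chosen one. -/
lemma IsSingularValues.nuclearNorm_eq {m n : ℕ} {Q : Matrix (Fin m) (Fin n) ℍ[ℝ]}
    {σ : Fin (min m n) → ℝ} (hσ : IsSingularValues Q σ) : nuclearNorm Q = ∑ k, σ k := by
  rw [nuclearNorm, schattenNorm, (isSingularValues_singularValues Q).unique hσ]
  simp

lemma IsSingularValues.sum_rpow_le {M N d : ℕ} {X : Matrix (Fin M) (Fin N) ℍ[ℝ]}
    {σ : Fin (min M N) → ℝ} (hσ : IsSingularValues X σ) {U : Matrix (Fin M) (Fin d) ℍ[ℝ]}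
    {V : Matrix (Fin N) (Fin d) ℍ[ℝ]} (hX : X = U * Vᴴ) :
    ∑ k, σ k ^ (2 / 3 : ℝ) ≤ (frobeniusNorm U ^ 2 + 2 * nuclearNorm V) / 3 := by
  obtain ⟨τ, hτ⟩ := exists_isSingularValues V
  obtain ⟨C, hC, E, hE, hV⟩ := hτ.exists_qsvd
  -- The left unitary factor of `V` is the test basis: it cancels and leaves a real diagonal scaling
  -- of the columns of `U E`.
  have hXC : X * C = U * E * (rectDiag τ)ᴴ := by
    have hC' : Cᴴ * C = 1 := hC.1
    rw [hX, hV]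
    simp only [conjTranspose_mul, conjTranspose_conjTranspose, Matrix.mul_assoc, hC', Matrix.mul_one]
  have h := sum_rpow_le_sum_col hσ hC (p := 1 / 3) (by norm_num) (by norm_num)
  rw [show (2 * (1 / 3) : ℝ) = 2 / 3 by norm_num] at h
  refine h.trans ?_
  rw [hτ.nuclearNorm_eq, ← frobeniusNorm_mul_unitary hE, frobeniusNorm_sq, hXC, Finset.sum_comm]
  set W := U * E
  -- Only the first `min N d` columns of `W` meet the diagonal; discarding the others can only lower
  -- the squared Frobenius norm.
  have h1 := sum_castLE_le (min_le_right N d) (fun j => ∑ i, ‖W i j‖ ^ 2) fun _ => by positivity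
  rw [← sum_castLE_eq (min_le_left N d)]
  · calc _ ≤ ∑ k : Fin (min N d),
          (∑ i, ‖W i (Fin.castLE (min_le_right N d) k)‖ ^ 2 + 2 * τ k) / 3 := by
          refine Finset.sum_le_sum fun k _ => ?_
          refine le_trans (le_of_eq ?_) (rpow_third_le (hτ.nonneg k) (by positivity))
          congr 1
          rw [Finset.mul_sum]
          refine Finset.sum_congr rfl fun i _ => ?_
          have hk : k.1 < d := by omega
          rw [norm_sq_mul_conjTranspose_rectDiag]
          simp [hk, Fin.castLE]
      _ ≤ _ := by
          rw [← Finset.sum_div, Finset.sum_add_distrib, ← Finset.mul_sum]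
          linarith
  -- Columns of `X C` beyond the diagonal of `V` are zero and contribute nothing.
  · intro j hj
    simp only [norm_sq_mul_conjTranspose_rectDiag, zeroExtend_of_le τ hj]
    simp

/-! ### Rank and vanishing singular values -/

/-- The columns of a unitary matrix are independent as right vectors. -/
lemma linearIndependent_col {m : ℕ} {A : Matrix (Fin m) (Fin m) ℍ[ℝ]} (hA : Aᴴ * A = 1) :
    LinearIndependent ℍ[ℝ]ᵐᵒᵖ A.col := by
  rw [Fintype.linearIndependent_iff]
  intro g hg j
  -- `op q` acts by right multiplication by `q`, so a right combination of the columns is `A`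
  -- applied to the vector of coefficients.
  have h1 : A *ᵥ (fun i => (g i).unop) = 0 := by
    rw [← hg]
    ext1 a
    simp [mulVec, dotProduct]
  have h2 : (fun i => (g i).unop) = 0 := by
    rw [← one_mulVec (fun i => (g i).unop), ← hA, ← mulVec_mulVec, h1, mulVec_zero]
  simpa using congrFun h2 j

lemma mulVec_mem_span_col {m n : ℕ} (Q : Matrix (Fin m) (Fin n) ℍ[ℝ]) (x : Fin n → ℍ[ℝ]) :
    Q *ᵥ x ∈ Submodule.span ℍ[ℝ]ᵐᵒᵖ (Set.range Q.col) := by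
  have : Q *ᵥ x = ∑ j, MulOpposite.op (x j) • Q.col j := by
    ext1 a
    simp [mulVec, dotProduct]
  rw [this]
  exact sum_mem fun j _ => Submodule.smul_mem _ _ (Submodule.subset_span ⟨j, rfl⟩)

/-- The singular values beyond the rank vanish. -/
lemma IsSingularValues.zeroExtend_eq_zero {m n d : ℕ} {Q : Matrix (Fin m) (Fin n) ℍ[ℝ]}
    {σ : Fin (min m n) → ℝ} (hσ : IsSingularValues Q σ) (hd : rank Q ≤ d) {k : ℕ} (hk : d ≤ k) :
    zeroExtend σ k = 0 := by
  by_contra hne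
  have hkl : k < min m n := by
    by_contra! h
    exact hne (zeroExtend_of_le σ h)
  -- By monotonicity, a nonzero singular value of index `k` forces `k + 1` positive ones, hence `k +
  -- 1` independent columns of `A` in the column space of `Q`, more than `d`.
  have hpos : ∀ i ≤ k, 0 < zeroExtend σ i := fun i hi =>
    ((zeroExtend_nonneg hσ.nonneg k).lt_of_ne' hne).trans_le
      (zeroExtend_antitone hσ.nonneg hσ.antitone hi)
  obtain ⟨A, hA, B, hB, hQ⟩ := hσ.exists_qsvd
  have hB' : Bᴴ * B = 1 := hB.1
  have hQB : Q * B = A * rectDiag σ := by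
    rw [hQ, Matrix.mul_assoc, hB', Matrix.mul_one]
  have hkm : k + 1 ≤ m := by omega
  let S := Submodule.span ℍ[ℝ]ᵐᵒᵖ (Set.range Q.col)
  have hmem : ∀ i : Fin (k + 1), A.col (Fin.castLE hkm i) ∈ S := by
    intro i
    have hin : i.1 < n := by omega
    have hi := hpos i.1 (by omega)
    have h : Q *ᵥ B.col ⟨i.1, hin⟩
        = MulOpposite.op ((zeroExtend σ i.1 : ℝ) : ℍ[ℝ]) • A.col (Fin.castLE hkm i) := by
      ext1 a
      have h1 : (Q *ᵥ B.col ⟨i.1, hin⟩) a = (Q * B) a ⟨i.1, hin⟩ := rfl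
      rw [h1, hQB, mul_apply, Finset.sum_eq_single (Fin.castLE hkm i)]
      · simp [rectDiag_apply]
      · intro b _ hb
        have : b.1 ≠ i.1 := fun h => hb (Fin.ext h)
        simp [rectDiag_apply, this]
      · simp
    have h2 := mulVec_mem_span_col Q (B.col ⟨i.1, hin⟩)
    rw [h] at h2
    refine (Submodule.smul_mem_iff _ ?_).mp h2
    rw [MulOpposite.op_ne_zero_iff, ← Quaternion.coe_zero]
    exact fun h => hi.ne' (Quaternion.coe_injective h)
  have hli : LinearIndependent ℍ[ℝ]ᵐᵒᵖ (fun i : Fin (k + 1) => (⟨_, hmem i⟩ : S)) := by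
    apply LinearIndependent.of_comp S.subtype
    exact (linearIndependent_col hA.1).comp _ (Fin.castLE_injective hkm)
  have : FiniteDimensional ℍ[ℝ]ᵐᵒᵖ S := FiniteDimensional.span_of_finite _ (Set.finite_range _)
  have hcard := hli.fintype_card_le_finrank
  rw [Fintype.card_fin] at hcard
  have : k + 1 ≤ rank Q := hcard
  omega

/-! ### Attainment: the optimal factorization -/

/-- The product of two rectangular diagonal matrices is rectangular diagonal. -/
lemma rectDiag_mul_conjTranspose {m n d : ℕ} (f g : ℕ → ℝ) (h : ℕ → ℝ)
    (hfg : ∀ k, f k * g k = h k) (hd : ∀ k, d ≤ k → h k = 0) :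
    (rectDiag (fun k : Fin (min m d) => f k) : Matrix (Fin m) (Fin d) ℍ[ℝ]) *
      (rectDiag (fun k : Fin (min n d) => g k) : Matrix (Fin n) (Fin d) ℍ[ℝ])ᴴ
      = rectDiag fun k : Fin (min m n) => h k := by
  ext1 i j
  rw [mul_apply]
  by_cases hi : i.1 < d
  · rw [Finset.sum_eq_single ⟨i.1, hi⟩]
    · by_cases hij : i.1 = j.1
      · simp [rectDiag, ← hfg, hij]
      · simp [rectDiag, hij, Ne.symm hij]
    · intro b _ hb
      have : i.1 ≠ b.1 := fun h => hb (Fin.ext h.symm)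
      simp [rectDiag, this]
    · simp
  -- The inner dimension `d` cuts the product off here, so `h` has to vanish from `d` on.
  · rw [Finset.sum_eq_zero]
    · simp [rectDiag, hd i.1 (by omega)]
    · intro b _
      have : i.1 ≠ b.1 := by omega
      simp [rectDiag, this]

lemma frobeniusNorm_rectDiag_sq {m n : ℕ} (σ : Fin (min m n) → ℝ) :
    frobeniusNorm (rectDiag σ : Matrix (Fin m) (Fin n) ℍ[ℝ]) ^ 2 = ∑ k, σ k ^ 2 := by
  have hrow : ∀ i : Fin m, ∑ j : Fin n, ‖(rectDiag σ : Matrix (Fin m) (Fin n) ℍ[ℝ]) i j‖ ^ 2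
      = zeroExtend σ i ^ 2 := by
    intro i
    by_cases hi : i.1 < n
    · rw [Finset.sum_eq_single ⟨i.1, hi⟩]
      · simp [rectDiag_apply]
      · intro b _ hb
        have : i.1 ≠ b.1 := fun h => hb (Fin.ext h.symm)
        simp [rectDiag_apply, this]
      · simp
    · rw [zeroExtend_of_le σ (by omega), Finset.sum_eq_zero]
      · simp
      · intro b _
        have : i.1 ≠ b.1 := by omega
        simp [rectDiag_apply, this]
  rw [frobeniusNorm_sq, Finset.sum_congr rfl fun i _ => hrow i]
  exact sum_zeroExtend (min_le_left m n) σ (fun t => t ^ 2) (by simp)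

lemma sum_fin_eq_of_eq_zero {a b : ℕ} (f : ℕ → ℝ) (ha : ∀ k, a ≤ k → f k = 0)
    (hb : ∀ k, b ≤ k → f k = 0) : ∑ k : Fin a, f k = ∑ k : Fin b, f k := by
  rcases le_total a b with h | h
  · exact sum_castLE_eq h (fun k => f k) fun k hk => ha k hk
  · exact (sum_castLE_eq h (fun k => f k) fun k hk => hb k hk).symm

/-- The factors `A D^(1/3)` and `B D^(2/3)` of `A D Bᴴ`. -/
lemma IsSingularValues.exists_factorization {M N d : ℕ} {X : Matrix (Fin M) (Fin N) ℍ[ℝ]}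
    {σ : Fin (min M N) → ℝ} (hσ : IsSingularValues X σ) (hd : rank X ≤ d) :
    ∃ (U : Matrix (Fin M) (Fin d) ℍ[ℝ]) (V : Matrix (Fin N) (Fin d) ℍ[ℝ]), X = U * Vᴴ ∧
      frobeniusNorm U ^ 2 = ∑ k, σ k ^ (2 / 3 : ℝ) ∧ nuclearNorm V = ∑ k, σ k ^ (2 / 3 : ℝ) := by
  obtain ⟨A, hA, B, hB, hX⟩ := hσ.exists_qsvd
  have hs := zeroExtend_nonneg hσ.nonneg
  have hsd : ∀ k, d ≤ k → zeroExtend σ k = 0 := fun k => hσ.zeroExtend_eq_zero hd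
  have hsl : ∀ k, min M N ≤ k → zeroExtend σ k = 0 := fun k => zeroExtend_of_le σ
  -- The diagonals of the factors have lengths `min M d` and `min N d`, that of `X` has length `min
  -- M N`. Past `min L d` the entry is zero either by shape or by the rank bound.
  have hmin : ∀ L, min M N ≤ L → ∀ k, min L d ≤ k → zeroExtend σ k ^ (2 / 3 : ℝ) = 0 := by
    intro L hL k hk
    rw [show zeroExtend σ k = 0 from (min_le_iff.mp hk).elim (fun h => hsl k (hL.trans h)) (hsd k)]
    exact Real.zero_rpow (by norm_num)
  have hsum : ∀ L, min M N ≤ L →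
      ∑ k : Fin (min L d), zeroExtend σ k ^ (2 / 3 : ℝ) = ∑ k, σ k ^ (2 / 3 : ℝ) := by
    intro L hL
    rw [sum_fin_eq_of_eq_zero (fun k => zeroExtend σ k ^ (2 / 3 : ℝ)) (hmin L hL) (b := min M N)]
    · simp
    · intro k hk
      simp only [hsl k hk]
      exact Real.zero_rpow (by norm_num)
  -- The exponents add up to 1, and both `σ ^ (1/3)` squared and `σ ^ (2/3)` itself equal `σ ^
  -- (2/3)`: the equality case of AM-GM.
  let D₁ : Matrix (Fin M) (Fin d) ℍ[ℝ] := rectDiag fun k => zeroExtend σ k ^ (1 / 3 : ℝ)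
  let D₂ : Matrix (Fin N) (Fin d) ℍ[ℝ] := rectDiag fun k => zeroExtend σ k ^ (2 / 3 : ℝ)
  refine ⟨A * D₁, B * D₂, ?_, ?_, ?_⟩
  · have h : D₁ * D₂ᴴ = rectDiag σ := by
      rw [rectDiag_mul_conjTranspose (fun k => zeroExtend σ k ^ (1 / 3 : ℝ))
        (fun k => zeroExtend σ k ^ (2 / 3 : ℝ)) (zeroExtend σ) (fun k => ?_) hsd]
      · simp
      · rw [← Real.rpow_add_of_nonneg (hs k) (by norm_num) (by norm_num)]
        norm_num
    rw [hX, ← h, conjTranspose_mul]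
    simp only [Matrix.mul_assoc]
  · rw [frobeniusNorm_isometry_mul hA.1, frobeniusNorm_rectDiag_sq, ← hsum M (min_le_left M N)]
    refine Finset.sum_congr rfl fun k _ => ?_
    rw [← Real.rpow_mul_natCast (hs k)]
    norm_num
  -- `B * D₂` is already a decomposition, with right factor 1; the power `2/3` preserves the
  -- decreasing order.
  · have hV : IsSingularValues (B * D₂) fun k => zeroExtend σ k ^ (2 / 3 : ℝ) := by
      refine ⟨fun k => Real.rpow_nonneg (hs k) _, fun i j hij => ?_, B, hB, 1, one_mem _, ?_⟩
      · exact Real.rpow_le_rpow (hs j) (zeroExtend_antitone hσ.nonneg hσ.antitone hij) (by norm_num)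
      · rw [conjTranspose_one, Matrix.mul_one]
    rw [hV.nuclearNorm_eq, hsum N (min_le_right M N)]

/-- A least element makes the set nonempty and bounded below, so `sInf` in `fnn` is a true minimum
and not a default value. -/
theorem isLeast_fnnValues {M N d : ℕ} (X : Matrix (Fin M) (Fin N) ℍ[ℝ]) (hd : rank X ≤ d) :
    IsLeast (fnnValues d X) (schattenNorm (2 / 3) X) := by
  have hσ := isSingularValues_singularValues X
  have hexp : (1 / (2 / 3) : ℝ) = 3 / 2 := by norm_num
  constructor
  · obtain ⟨U, V, hX, hU, hV⟩ := hσ.exists_factorization hd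
    refine ⟨U, V, hX, ?_⟩
    rw [hU, hV, schattenNorm, hexp]
    congr 1
    ring
  · rintro t ⟨U, V, hX, rfl⟩
    rw [schattenNorm, hexp]
    exact Real.rpow_le_rpow (Finset.sum_nonneg fun k _ => Real.rpow_nonneg (hσ.nonneg k) _)
      (hσ.sum_rpow_le hX) (by norm_num)

end QuaternionMatrix

theorem theorem5 (M N d : ℕ) (X : Matrix (Fin M) (Fin N) ℍ[ℝ])
    (hd : QuaternionMatrix.rank X ≤ d) :
    IsLeast (QuaternionMatrix.fnnValues d X) (QuaternionMatrix.fnn d X) ∧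
      QuaternionMatrix.fnn d X = QuaternionMatrix.schattenNorm (2 / 3) X := by
  have h := QuaternionMatrix.isLeast_fnnValues X hd
  have heq : QuaternionMatrix.fnn d X = QuaternionMatrix.schattenNorm (2 / 3) X := h.csInf_eq
  exact ⟨heq ▸ h, heq⟩
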